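/- All graphs are simple, undirected and unweighted, on a common finite vertex set $V$ with $n=|V|$ and two distinct fixed vertices $s,t\in V$. Write $\nu(G)$ for the minimum value of an $s$-$t$ cut of $G$, i.e. the minimum of $|E_G(S,V\setminus S)|$ over $S\subseteq V$ with $s\in S$, $t\notin S$ (equivalently, the maximum $s$-$t$ flow value), and $H\preceq G$ if $E(H)\subseteq E(G)$. A deterministic cut-query algorithm adaptively asks a hidden graph $G$ for the values $|E_G(S,V\setminus S)|$ of cuts of its choice; its cost is the number of queries, and local computation is free. There are absolute constants $C$ and $c$ such that the following holds. Let $f$ and $k>0$ be known real parameters, and let $H$ be an explicitly given graph on $V$ with $\nu(H)\ge f-k$. Then there is a deterministic cut-query algorithm which, for every hidden graph $G$ on $V$ with $H\preceq G$ and $\nu(G)\ge f$, makes at most $C\,\frac{n^2}{\sqrt k}\,(\log n)^{c}=\widetilde O\!\left(n^2/\sqrt k\right)$ cut queries to $G$ and outputs a graph $H^{\mathrm{after}}\preceq G$ with $\nu(H^{\mathrm{after}})\ge f-\frac k2$. -/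

import Mathlib

namespace CutQuery

universe u v

open Classical in
/-- The number `|E_G(S, V \ S)|` of edges of the undirected graph `G` crossing the cut
`(S, V \ S)`. -/
noncomputable def cutSize {V : Type u} [Fintype V] (G : SimpleGraph V) (S : Finset V) : ℕ :=
  (G.interedges S Sᶜ).card

/-- The minimum `s`-`t` cut value `ν(G)`: the least value of a cut `(S, V \ S)` with `s ∈ S` and
`t ∉ S`. Such a cut exists as soon as `s ≠ t`, so the infimum is then a minimum. -/
noncomputable def nu {V : Type u} [Fintype V] (s t : V) (G : SimpleGraph V) : ℕ :=
  sInf {c : ℕ | ∃ S : Finset V, s ∈ S ∧ t ∉ S ∧ cutSize G S = c}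

/-- A deterministic adaptive query algorithm on the vertex set `V`, as a decision tree: it either
stops with an output, or asks for the value of a cut `(S, V \ S)` and continues depending on the
number it receives. Local computation is free. -/
inductive Algorithm (V : Type u) (α : Type v) : Type (max u v)
  | output (a : α) : Algorithm V α
  | query (S : Finset V) (next : ℕ → Algorithm V α) : Algorithm V α

namespace Algorithm

/-- The output of the algorithm when the hidden input graph is `G`. -/
noncomputable def result {V : Type u} {α : Type v} [Fintype V] (G : SimpleGraph V) :
    Algorithm V α → α
  | output a => a
  | query S next => result G (next (cutSize G S))

/-- The number of cut queries the algorithm makes when the hidden input graph is `G`. -/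
noncomputable def numQueries {V : Type u} {α : Type v} [Fintype V] (G : SimpleGraph V) :
    Algorithm V α → ℕ
  | output _ => 0
  | query S next => numQueries G (next (cutSize G S)) + 1

end Algorithm

end CutQuery

/-! The algorithm is push-relabel on `G`, moving one unit at a time from `s`, with labels cut off at
`D + 1`, where `D` is about `2n/√k`. Flow and labels are known, so a step only has to find one edge
of `G` from a vertex into an explicit set of candidates, or learn that there is none. Binary search
does this with `O(log n)` queries (`exists_neighbor_search`). A potential of size `O(nD)` bounds the
number of steps (`exists_loop`), which gives `O(n² log n / √k)` queries.

Units that climb to label `D + 1` are left there. When all edges at `s` are saturated, a residual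
arc descends at most one level, so the cut between levels `i + 1` and `i` exceeds the flow into `t`
by at most twice the product of their sizes (`State.Valid.nu_le`). The levels are disjoint, so some
consecutive pair among the `D` available is small enough to make this loss at most `k/2`. The output
is the support of the preflow: it contains only edges of `G`, and its minimum cut is at least the
excess at `t`. -/

namespace CutQuery

universe u v w

open Finset

/-! ### Cut values and adjacency. -/

section Cuts

variable {V : Type u} [Fintype V]

open Classical in
theorem cutSize_eq_sum (G : SimpleGraph V) (S : Finset V) :
    cutSize G S = ∑ a ∈ S, ∑ b ∈ Sᶜ, if G.Adj a b then 1 else 0 := by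
  rw [cutSize, SimpleGraph.interedges, Rel.interedges, card_filter, sum_product]

open Classical in
/-- Three cut values determine the number of edges between a vertex and a set. -/
theorem cutSize_singleton_add (G : SimpleGraph V) {u : V} {B : Finset V} (hu : u ∉ B) :
    cutSize G {u} + cutSize G B =
      cutSize G (insert u B) + 2 * ∑ b ∈ B, if G.Adj u b then 1 else 0 := by
  have h1 : ({u} : Finset V)ᶜ = B ∪ (insert u B)ᶜ := by
    ext x
    simp only [mem_compl, mem_singleton, mem_union, mem_insert]
    by_cases hx : x = u
    · subst hx; simp [hu]
    · simp [hx, Classical.em]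
  have h2 : Bᶜ = insert u (insert u B)ᶜ := by
    ext x
    simp only [mem_compl, mem_insert]
    by_cases hx : x = u
    · subst hx; simp [hu]
    · simp [hx]
  have hd : Disjoint B (insert u B)ᶜ := by
    rw [Finset.disjoint_left]
    intro x hx
    simp [hx]
  rw [cutSize_eq_sum, cutSize_eq_sum, cutSize_eq_sum, sum_insert hu, sum_singleton, h1,
    sum_union hd, h2]
  have h3 : ∀ a ∈ B, (∑ b ∈ insert u (insert u B)ᶜ, if G.Adj a b then 1 else 0) =
      (if G.Adj u a then 1 else 0) + ∑ b ∈ (insert u B)ᶜ, if G.Adj a b then 1 else 0 := by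
    intro a _
    rw [sum_insert (by simp), G.adj_comm a u]
  rw [sum_congr rfl h3, sum_add_distrib]
  ring

theorem exists_adj_iff_cutSize (G : SimpleGraph V) [DecidableEq V] {u : V}
    {B : Finset V} (hu : u ∉ B) :
    (∃ b ∈ B, G.Adj u b) ↔ cutSize G {u} + cutSize G B ≠ cutSize G (insert u B) := by
  classical
  have h := cutSize_singleton_add G hu
  have h0 : (∑ b ∈ B, if G.Adj u b then 1 else 0) = 0 ↔ ¬ ∃ b ∈ B, G.Adj u b := by
    rw [sum_eq_zero_iff]
    push Not
    simp
  rw [← not_iff_not, ← h0]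
  have e : (insert u B : Finset V) = @insert _ _ (@Finset.instInsert V (fun a b => Classical.propDecidable (a = b))) u B := by
    congr!
  rw [e]
  push Not
  omega

theorem nu_le_cutSize {s t : V} (G : SimpleGraph V) {S : Finset V} (hs : s ∈ S) (ht : t ∉ S) :
    nu s t G ≤ cutSize G S :=
  Nat.sInf_le ⟨S, hs, ht, rfl⟩

theorem le_nu {s t : V} (hst : s ≠ t) (G : SimpleGraph V) {m : ℕ}
    (h : ∀ S : Finset V, s ∈ S → t ∉ S → m ≤ cutSize G S) : m ≤ nu s t G := by
  refine le_csInf ⟨_, {s}, by simp, by simpa using hst.symm, rfl⟩ ?_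
  rintro _ ⟨S, hs, ht, rfl⟩
  exact h S hs ht

theorem nu_le_card {s t : V} (hst : s ≠ t) (G : SimpleGraph V) : nu s t G ≤ Fintype.card V := by
  classical
  refine (nu_le_cutSize G (mem_singleton_self s) (by simpa using hst.symm)).trans ?_
  refine (SimpleGraph.card_interedges_le_mul G _ _).trans ?_
  simpa using card_le_univ _

end Cuts

/-! ### Composition of query algorithms. -/

namespace Algorithm

variable {V : Type u} {α : Type v} {β : Type w}

/-- Run an algorithm, then continue with one that depends on its output. -/
def bind : Algorithm V α → (α → Algorithm V β) → Algorithm V β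
  | output a, F => F a
  | query S next, F => query S fun m => bind (next m) F

variable [Fintype V]

theorem result_bind (G : SimpleGraph V) (A : Algorithm V α) (F : α → Algorithm V β) :
    (A.bind F).result G = (F (A.result G)).result G := by
  induction A with
  | output a => rfl
  | query S next ih => exact ih _

theorem numQueries_bind (G : SimpleGraph V) (A : Algorithm V α) (F : α → Algorithm V β) :
    (A.bind F).numQueries G = A.numQueries G + (F (A.result G)).numQueries G := by
  induction A with
  | output a => simp [bind, numQueries, result]
  | query S next ih => simp only [bind, numQueries, result, ih]; omega

end Algorithm

/-! ### Finding a neighbour by binary search. -/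

section Search

variable {V : Type u} [Fintype V]

theorem exists_adj_test (u : V) (B : Finset V) (hu : u ∉ B) :
    ∃ A : Algorithm V Prop, ∀ G : SimpleGraph V,
      A.numQueries G = 3 ∧ (A.result G ↔ ∃ b ∈ B, G.Adj u b) := by
  classical
  refine ⟨.query {u} fun x => .query B fun y => .query (insert u B) fun z => .output (x + y ≠ z),
    fun G => ⟨rfl, ?_⟩⟩
  rw [exists_adj_iff_cutSize G hu]
  rfl

/-- Binary search for a neighbour in a set known to contain one. -/
theorem exists_neighbor_search_of_exists (u : V) (m : ℕ) (B : Finset V) (hu : u ∉ B)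
    (hB : B.card ≤ 2 ^ m) :
    ∃ A : Algorithm V (Option V), ∀ G : SimpleGraph V, (∃ b ∈ B, G.Adj u b) →
      A.numQueries G ≤ 3 * m ∧ ∃ b ∈ B, A.result G = some b ∧ G.Adj u b := by
  classical
  induction m generalizing B with
  | zero =>
    rcases B.eq_empty_or_nonempty with rfl | ⟨b, hb⟩
    · exact ⟨.output none, fun G hG => by simp at hG⟩
    · refine ⟨.output (some b), fun G hG => ⟨by simp [Algorithm.numQueries], b, hb, rfl, ?_⟩⟩
      obtain ⟨b', hb', h⟩ := hG
      rwa [card_le_one.1 (by simpa using hB) b hb b' hb']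
  | succ m ih =>
    obtain ⟨B₁, hB₁, hc⟩ := exists_subset_card_eq (s := B) (n := min B.card (2 ^ m))
      (min_le_left _ _)
    have hc₂ : (B \ B₁).card ≤ 2 ^ m := by
      rw [card_sdiff_of_subset hB₁, hc]
      rw [pow_succ] at hB
      omega
    have hu₁ : u ∉ B₁ := fun h => hu (hB₁ h)
    obtain ⟨T, hT⟩ := exists_adj_test u B₁ hu₁
    obtain ⟨A₁, hA₁⟩ := ih B₁ hu₁ (by omega)
    obtain ⟨A₂, hA₂⟩ := ih (B \ B₁) (fun h => hu (mem_sdiff.1 h).1) hc₂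
    refine ⟨T.bind fun p => if p then A₁ else A₂, fun G hG => ?_⟩
    rw [Algorithm.numQueries_bind, Algorithm.result_bind, (hT G).1]
    by_cases hp : T.result G
    · obtain ⟨h1, b, hb, h2⟩ := hA₁ G ((hT G).2.1 hp)
      simp only [hp, if_true]
      exact ⟨by omega, b, hB₁ hb, h2⟩
    · have hG₂ : ∃ b ∈ B \ B₁, G.Adj u b := by
        obtain ⟨b, hb, h⟩ := hG
        exact ⟨b, mem_sdiff.2 ⟨hb, fun hb₁ => hp ((hT G).2.2 ⟨b, hb₁, h⟩)⟩, h⟩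
      obtain ⟨h1, b, hb, h2⟩ := hA₂ G hG₂
      simp only [hp, if_false]
      exact ⟨by omega, b, (mem_sdiff.1 hb).1, h2⟩

/-- One initial test removes the promise that a neighbour exists, at the price of three more
queries. -/
theorem exists_neighbor_search (u : V) (B : Finset V) (hu : u ∉ B) :
    ∃ A : Algorithm V (Option V), ∀ G : SimpleGraph V,
      A.numQueries G ≤ 3 * (Nat.clog 2 (Fintype.card V) + 1) ∧
      ((A.result G = none ∧ ∀ b ∈ B, ¬ G.Adj u b) ∨
        ∃ b ∈ B, A.result G = some b ∧ G.Adj u b) := by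
  classical
  obtain ⟨T, hT⟩ := exists_adj_test u B hu
  obtain ⟨A, hA⟩ := exists_neighbor_search_of_exists u (Nat.clog 2 (Fintype.card V)) B hu
    ((card_le_univ B).trans (Nat.le_pow_clog one_lt_two _))
  refine ⟨T.bind fun p => if p then A else .output none, fun G => ?_⟩
  rw [Algorithm.numQueries_bind, Algorithm.result_bind, (hT G).1]
  by_cases hp : T.result G
  · obtain ⟨h1, h2⟩ := hA G ((hT G).2.1 hp)
    simp only [hp, if_true]
    exact ⟨by omega, Or.inr h2⟩
  · simp only [hp, if_false, Algorithm.numQueries, Algorithm.result]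
    refine ⟨by omega, Or.inl ⟨trivial, fun b hb h => hp ((hT G).2.2 ⟨b, hb, h⟩)⟩⟩

end Search

/-! ### Unit-capacity preflows. -/

section Preflow

variable {V : Type u} [Fintype V]

/-- The net inflow of `φ` at a vertex. -/
def excess (φ : V → V → ℤ) (x : V) : ℤ := ∑ a, φ a x

open Classical in
/-- One more unit sent from `u` to `v`. -/
noncomputable def push (φ : V → V → ℤ) (u v : V) (a b : V) : ℤ :=
  φ a b + (if a = u ∧ b = v then 1 else 0) - (if a = v ∧ b = u then 1 else 0)

open Classical in
theorem excess_push (φ : V → V → ℤ) (u v x : V) :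
    excess (push φ u v) x = excess φ x + (if x = v then 1 else 0) - (if x = u then 1 else 0) := by
  simp only [excess, push, sum_sub_distrib, sum_add_distrib]
  congr 1
  · congr 1
    by_cases h : x = v <;> simp [h]
  · by_cases h : x = u <;> simp [h]

/-- An integral preflow from `s` in the graph `G` with unit capacities. -/
structure IsPreflow (G : SimpleGraph V) (s : V) (φ : V → V → ℤ) : Prop where
  antisymm : ∀ a b, φ b a = -φ a b
  le_one : ∀ a b, φ a b ≤ 1
  adj : ∀ a b, φ a b ≠ 0 → G.Adj a b
  excess_nonneg : ∀ x, x ≠ s → 0 ≤ excess φ x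

theorem IsPreflow.self_eq_zero {G : SimpleGraph V} {s : V} {φ : V → V → ℤ}
    (h : IsPreflow G s φ) (a : V) : φ a a = 0 := by
  have := h.antisymm a a
  omega

-- By antisymmetry the flow inside `Sᶜ` cancels, leaving only what crosses the cut.
open Classical in
theorem sum_cut_eq_sum_excess {φ : V → V → ℤ} (h : ∀ a b, φ b a = -φ a b) (S : Finset V) :
    ∑ a ∈ S, ∑ b ∈ Sᶜ, φ a b = ∑ b ∈ Sᶜ, excess φ b := by
  have h0 : ∑ b ∈ Sᶜ, ∑ a ∈ Sᶜ, φ a b = 0 := by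
    have h1 : ∑ b ∈ Sᶜ, ∑ a ∈ Sᶜ, φ a b = -∑ b ∈ Sᶜ, ∑ a ∈ Sᶜ, φ a b := by
      conv_lhs => rw [sum_comm]
      rw [← sum_neg_distrib]
      refine sum_congr rfl fun b _ => ?_
      rw [← sum_neg_distrib]
      exact sum_congr rfl fun a _ => h a b
    omega
  have h2 : ∀ b ∈ Sᶜ, excess φ b = ∑ a ∈ S, φ a b + ∑ a ∈ Sᶜ, φ a b := fun b _ =>
    (sum_add_sum_compl S fun a => φ a b).symm
  rw [sum_congr rfl h2, sum_add_distrib, h0, add_zero, sum_comm]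

theorem IsPreflow.push {G : SimpleGraph V} {s : V} {φ : V → V → ℤ} (h : IsPreflow G s φ)
    {u v : V} (huv : G.Adj u v) (hφ : φ u v ≠ 1) (hu : u = s ∨ 0 < excess φ u) :
    IsPreflow G s (push φ u v) where
  antisymm a b := by
    have := h.antisymm a b
    by_cases h1 : a = u ∧ b = v <;> by_cases h2 : a = v ∧ b = u <;>
      simp only [CutQuery.push, and_comm (a := b = u), and_comm (a := b = v), h1, h2, and_self,
        if_true, if_false] <;> grind
  le_one a b := by
    have := h.le_one a b
    simp only [CutQuery.push]
    by_cases h1 : a = u ∧ b = v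
    · obtain ⟨rfl, rfl⟩ := h1
      rw [if_pos ⟨rfl, rfl⟩, if_neg fun h2 => huv.ne h2.1]
      omega
    · rw [if_neg h1]
      split_ifs <;> omega
  adj a b hab := by
    by_cases h1 : a = u ∧ b = v
    · obtain ⟨rfl, rfl⟩ := h1; exact huv
    · by_cases h2 : a = v ∧ b = u
      · obtain ⟨rfl, rfl⟩ := h2; exact huv.symm
      · refine h.adj a b ?_
        simpa [CutQuery.push, h1, h2] using hab
  excess_nonneg x hx := by
    rw [excess_push]
    have h1 := h.excess_nonneg x hx
    by_cases h2 : x = u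
    · subst h2
      have h3 := hu.resolve_left hx
      split_ifs <;> omega
    · rw [if_neg h2]
      split_ifs <;> omega

/-- The graph of the edges that carry flow. -/
def supportGraph (φ : V → V → ℤ) : SimpleGraph V :=
  SimpleGraph.fromRel fun a b => φ a b ≠ 0

theorem IsPreflow.supportGraph_le {G : SimpleGraph V} {s : V} {φ : V → V → ℤ}
    (h : IsPreflow G s φ) : supportGraph φ ≤ G := by
  intro a b hab
  obtain ⟨-, hab | hab⟩ := hab
  · exact h.adj a b hab
  · exact (h.adj b a hab).symm

/-- Excess stranded on the sink side of a cut only adds to the flow across it, so the preflow need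
not be turned into a flow. -/
theorem IsPreflow.excess_le_nu_supportGraph {G : SimpleGraph V} {s t : V} (hst : s ≠ t)
    {φ : V → V → ℤ} (h : IsPreflow G s φ) :
    excess φ t ≤ nu s t (supportGraph φ) := by
  classical
  rw [← Int.toNat_of_nonneg (h.excess_nonneg t hst.symm), Int.ofNat_le]
  refine le_nu hst _ fun S hs ht => ?_
  rw [Int.toNat_le]
  calc excess φ t ≤ ∑ b ∈ Sᶜ, excess φ b :=
        single_le_sum (f := fun b => excess φ b)
          (fun b hb => h.excess_nonneg b (by rintro rfl; exact (mem_compl.1 hb) hs))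
          (mem_compl.2 ht)
    _ = ∑ a ∈ S, ∑ b ∈ Sᶜ, φ a b := (sum_cut_eq_sum_excess h.antisymm S).symm
    _ ≤ (cutSize (supportGraph φ) S : ℤ) := by
        rw [cutSize_eq_sum]
        push_cast
        refine sum_le_sum fun a _ => sum_le_sum fun b _ => ?_
        split_ifs with hab
        · exact h.le_one a b
        · by_contra! hlt
          refine hab ⟨?_, Or.inl hlt.ne'⟩
          rintro rfl
          rw [h.self_eq_zero] at hlt
          omega

/-! ### Push-relabel with truncated labels. -/

/-- The state of the algorithm: a preflow, distance labels, and the position of the unit of flow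
that is being moved. -/
structure State (V : Type u) where
  flow : V → V → ℤ
  label : V → ℕ
  cur : V

open Classical in
/-- The invariant of the push-relabel loop with labels cut off at `D + 1`. -/
structure State.Valid (D : ℕ) (s t : V) (G : SimpleGraph V) (σ : State V) : Prop where
  preflow : IsPreflow G s σ.flow
  label_source : σ.label s = D + 1
  label_target : σ.label t = 0
  label_le : ∀ x, σ.label x ≤ D + 1
  label_le_succ : ∀ a b, a ≠ s → G.Adj a b → σ.flow a b ≠ 1 → σ.label a ≤ σ.label b + 1
  excess_eq : ∀ x, x ≠ s → x ≠ t → σ.label x ≤ D →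
    excess σ.flow x = if x = σ.cur then 1 else 0

open Classical in
/-- The potential that bounds the number of remaining steps. -/
noncomputable def State.potential (D : ℕ) (s : V) (σ : State V) : ℕ :=
  (Fintype.card V + excess σ.flow s).toNat * (D + 3) + 2 * ∑ x, (D + 1 - σ.label x) +
    if σ.cur = s then 0 else σ.label σ.cur + 1

variable {D : ℕ} {s t : V} {G : SimpleGraph V} {σ : State V}

theorem IsPreflow.neg_card_le_excess {φ : V → V → ℤ} (h : IsPreflow G s φ) (x : V) :
    0 ≤ Fintype.card V + excess φ x := by
  have : ∑ _a : V, (-1 : ℤ) ≤ ∑ a, φ a x := sum_le_sum fun a _ => by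
    have h1 := h.antisymm x a
    have h2 := h.le_one x a
    omega
  simp at this
  unfold excess
  omega

/-- The unit leaves the source. -/
theorem State.Valid.start (h : σ.Valid D s t G) (hst : s ≠ t) (hc : σ.cur = s) {v : V}
    (hv : G.Adj s v) (hφ : σ.flow s v ≠ 1) :
    State.Valid D s t G ⟨push σ.flow s v, σ.label, v⟩ ∧
      State.potential D s ⟨push σ.flow s v, σ.label, v⟩ < σ.potential D s := by
  classical
  have hvs : v ≠ s := hv.ne'
  refine ⟨⟨h.preflow.push hv hφ (Or.inl rfl), h.label_source, h.label_target, h.label_le, ?_, ?_⟩,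
    ?_⟩
  · intro a b ha hab hf
    -- The only arc that can become residual is the one back to `s`, whose label is maximal.
    by_cases hsv : a = v ∧ b = s
    · obtain ⟨rfl, rfl⟩ := hsv
      have := h.label_le a
      have := h.label_source
      simp only
      omega
    · refine h.label_le_succ a b ha hab ?_
      simpa [push, hsv, ha] using hf
  · intro x hxs hxt hx
    have := h.excess_eq x hxs hxt hx
    rw [hc, if_neg hxs] at this
    simp only [excess_push, this, if_neg hxs]
    simp
  -- The excess of `s` drops by one, releasing `D + 3`, while the new position costs `label v + 1 ≤
  -- D + 2`.
  · have h1 := h.preflow.neg_card_le_excess s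
    have h2 := (h.preflow.push hv hφ (Or.inl rfl)).neg_card_le_excess s
    have h3 := h.label_le v
    simp only [State.potential, excess_push, if_neg hvs, if_neg hvs.symm, hc, if_true] at h2 ⊢
    obtain ⟨m, hm⟩ := Int.eq_ofNat_of_zero_le h2
    have e1 : (Fintype.card V + excess σ.flow s).toNat = m + 1 := by omega
    have e2 : (Fintype.card V + (excess σ.flow s + 0 - 1)).toNat = m := by omega
    rw [e1, e2, add_mul]
    omega

/-- The unit has arrived at the target, or at a vertex whose label is too large. -/
theorem State.Valid.reset (h : σ.Valid D s t G) (hc : σ.cur ≠ s)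
    (hc' : σ.cur = t ∨ D < σ.label σ.cur) :
    State.Valid D s t G ⟨σ.flow, σ.label, s⟩ ∧
      State.potential D s ⟨σ.flow, σ.label, s⟩ < σ.potential D s := by
  classical
  refine ⟨⟨h.preflow, h.label_source, h.label_target, h.label_le, h.label_le_succ, ?_⟩, ?_⟩
  · intro x hxs hxt hx
    have := h.excess_eq x hxs hxt hx
    rw [if_neg] at this
    · simpa [hxs] using this
    · rintro rfl
      rcases hc' with h1 | h1
      · exact hxt h1
      · simp only at hx; omega
  · simp [State.potential, hc]

/-- The unit moves along an admissible arc. -/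
theorem State.Valid.advance (h : σ.Valid D s t G) (hs : σ.cur ≠ s) (ht : σ.cur ≠ t)
    (hD : σ.label σ.cur ≤ D) {v : V} (hv : G.Adj σ.cur v) (hφ : σ.flow σ.cur v ≠ 1)
    (hl : σ.label v + 1 = σ.label σ.cur) :
    State.Valid D s t G ⟨push σ.flow σ.cur v, σ.label, v⟩ ∧
      State.potential D s ⟨push σ.flow σ.cur v, σ.label, v⟩ < σ.potential D s := by
  classical
  have hvs : v ≠ s := by
    rintro rfl
    have := h.label_source
    omega
  have hex := h.excess_eq _ hs ht hD
  rw [if_pos rfl] at hex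
  refine ⟨⟨h.preflow.push hv hφ (Or.inr (by omega)), h.label_source, h.label_target, h.label_le,
    ?_, ?_⟩, ?_⟩
  · intro a b ha hab hf
    -- The reverse arc may become residual, but it goes up one level.
    by_cases h1 : a = v ∧ b = σ.cur
    · obtain ⟨rfl, rfl⟩ := h1
      simp only
      omega
    · by_cases h2 : a = σ.cur ∧ b = v
      · obtain ⟨rfl, rfl⟩ := h2
        simp only
        omega
      · refine h.label_le_succ a b ha hab ?_
        simpa [push, h1, h2] using hf
  · intro x hxs hxt hx
    have := h.excess_eq x hxs hxt hx
    simp only [excess_push, this]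
    split_ifs <;> omega
  · simp only [State.potential, excess_push, if_neg hvs, if_neg hvs.symm, if_neg hs, if_neg hs.symm,
      add_zero, sub_zero]
    omega

open Classical in
/-- There is no admissible arc, so the label increases. -/
theorem State.Valid.relabel (h : σ.Valid D s t G) (hs : σ.cur ≠ s) (ht : σ.cur ≠ t)
    (hD : σ.label σ.cur ≤ D)
    (hn : ∀ v, G.Adj σ.cur v → σ.flow σ.cur v ≠ 1 → σ.label v + 1 ≠ σ.label σ.cur) :
    State.Valid D s t G ⟨σ.flow, Function.update σ.label σ.cur (σ.label σ.cur + 1), σ.cur⟩ ∧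
      State.potential D s ⟨σ.flow, Function.update σ.label σ.cur (σ.label σ.cur + 1), σ.cur⟩ <
        σ.potential D s := by
  have hle : ∀ x, σ.label x ≤ Function.update σ.label σ.cur (σ.label σ.cur + 1) x := by
    intro x
    rw [Function.update_apply]
    split_ifs with hx
    · subst hx; omega
    · exact le_rfl
  refine ⟨⟨h.preflow, ?_, ?_, ?_, ?_, ?_⟩, ?_⟩
  · simpa [Function.update_of_ne hs.symm] using h.label_source
  · simpa [Function.update_of_ne ht.symm] using h.label_target
  · intro x
    simp only [Function.update_apply]
    split_ifs
    · omega
    · exact h.label_le x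
  · intro a b ha hab hf
    have h1 := h.label_le_succ a b ha hab hf
    have h2 := hle b
    by_cases hac : a = σ.cur
    · subst hac
      have h3 := hn b hab hf
      simp only [Function.update_self]
      omega
    · simp only [Function.update_of_ne hac]
      omega
  · intro x hxs hxt hx
    exact h.excess_eq x hxs hxt ((hle x).trans hx)
  -- The factor 2 in the potential matters here: the sum releases 2 and the higher position costs 1.
  · have hsum : ∑ x, (D + 1 - Function.update σ.label σ.cur (σ.label σ.cur + 1) x) + 1 ≤
        ∑ x, (D + 1 - σ.label x) := by
      refine Nat.succ_le_of_lt (sum_lt_sum (fun x _ => ?_) ⟨σ.cur, mem_univ _, ?_⟩)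
      · have := hle x
        omega
      · simp only [Function.update_self]
        omega
    simp only [State.potential, if_neg hs, Function.update_self]
    omega

/-- Running the push-relabel loop to its end costs a logarithmic number of queries per unit of
potential. -/
theorem exists_loop (hst : s ≠ t) (D N : ℕ) (σ : State V) :
    ∃ A : Algorithm V (State V), ∀ G : SimpleGraph V, σ.Valid D s t G → σ.potential D s < N →
      A.numQueries G ≤ 3 * (Nat.clog 2 (Fintype.card V) + 1) * N ∧
      (A.result G).Valid D s t G ∧ (A.result G).cur = s ∧
      ∀ v, G.Adj s v → (A.result G).flow s v = 1 := by
  classical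
  induction N generalizing σ with
  | zero => exact ⟨.output σ, fun G _ h => by omega⟩
  | succ N ih =>
    choose A hA using ih
    set q := 3 * (Nat.clog 2 (Fintype.card V) + 1)
    by_cases hs : σ.cur = s
    -- A search with no result certifies that every edge at `s` is saturated.
    · obtain ⟨T, hT⟩ := exists_neighbor_search s
        (univ.filter fun v => v ≠ s ∧ σ.flow s v ≠ 1) (by simp)
      refine ⟨T.bind fun o => o.elim (.output σ) fun v => A ⟨push σ.flow s v, σ.label, v⟩,
        fun G hG hN => ?_⟩
      rw [Algorithm.numQueries_bind, Algorithm.result_bind, Nat.mul_succ]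
      obtain ⟨h1, ⟨h2, h3⟩ | ⟨v, hv, h2, h3⟩⟩ := hT G
      · rw [h2]
        refine ⟨?_, hG, hs, fun v hv => ?_⟩
        · simp only [Option.elim, Algorithm.numQueries]
          exact h1.trans (Nat.le_add_left _ _)
        · by_contra hne
          exact h3 v (mem_filter.2 ⟨mem_univ _, hv.ne', hne⟩) hv
      · rw [h2]
        obtain ⟨h4, h5⟩ := hG.start hst hs h3 (by simp at hv; exact hv.2)
        obtain ⟨h6, h7⟩ := hA _ G h4 (by omega)
        refine ⟨?_, h7⟩
        rw [add_comm]
        exact Nat.add_le_add h6 h1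
    by_cases ht : σ.cur = t ∨ D < σ.label σ.cur
    · refine ⟨A ⟨σ.flow, σ.label, s⟩, fun G hG hN => ?_⟩
      obtain ⟨h4, h5⟩ := hG.reset hs ht
      obtain ⟨h6, h7⟩ := hA _ G h4 (by omega)
      exact ⟨h6.trans (Nat.mul_le_mul_left _ (Nat.le_succ N)), h7⟩
    push Not at ht
    obtain ⟨T, hT⟩ := exists_neighbor_search σ.cur
      (univ.filter fun v => σ.label v + 1 = σ.label σ.cur ∧ σ.flow σ.cur v ≠ 1) (by simp)
    refine ⟨T.bind fun o => o.elim
      (A ⟨σ.flow, Function.update σ.label σ.cur (σ.label σ.cur + 1), σ.cur⟩)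
      fun v => A ⟨push σ.flow σ.cur v, σ.label, v⟩, fun G hG hN => ?_⟩
    rw [Algorithm.numQueries_bind, Algorithm.result_bind, Nat.mul_succ, add_comm]
    obtain ⟨h1, ⟨h2, h3⟩ | ⟨v, hv, h2, h3⟩⟩ := hT G
    · rw [h2]
      obtain ⟨h4, h5⟩ := hG.relabel hs ht.1 ht.2 fun v hv hf hl => h3 v (by simp [hl, hf]) hv
      obtain ⟨h6, h7⟩ := hA _ G h4 (by omega)
      exact ⟨Nat.add_le_add h6 h1, h7⟩
    · rw [h2]
      simp only [mem_filter, mem_univ, true_and] at hv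
      obtain ⟨h4, h5⟩ := hG.advance hs ht.1 ht.2 h3 hv.2 hv.1
      obtain ⟨h6, h7⟩ := hA _ G h4 (by omega)
      exact ⟨Nat.add_le_add h6 h1, h7⟩

-- The zero flow is valid for every `G`, so no query is needed to start: the label condition exempts
-- arcs leaving `s`, and all other labels are 0.
open Classical in
theorem exists_valid_state (hst : s ≠ t) (D : ℕ) :
    ∃ σ : State V, (∀ G, σ.Valid D s t G) ∧
      σ.potential D s < 3 * Fintype.card V * (D + 3) := by
  have hpos : 0 < Fintype.card V := Fintype.card_pos_iff.2 ⟨s⟩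
  refine ⟨⟨fun _ _ => 0, fun x => if x = s then D + 1 else 0, s⟩, fun G => ⟨⟨?_, ?_, ?_, ?_⟩,
    ?_, ?_, ?_, ?_, ?_⟩, ?_⟩
  · simp
  · simp
  · simp
  · simp [excess]
  · simp
  · simp [hst.symm]
  · intro x
    simp only
    split_ifs <;> omega
  · intro a b ha
    simp [ha]
  · intro x hxs
    simp [excess, hxs]
  · simp only [State.potential, excess, sum_const_zero, add_zero, Int.toNat_natCast, if_true]
    have : ∑ x : V, (D + 1 - if x = s then D + 1 else 0) ≤ Fintype.card V * (D + 1) := by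
      refine (sum_le_card_nsmul _ _ (D + 1) fun x _ => Nat.sub_le _ _).trans ?_
      simp
    nlinarith

/-! ### Level cuts and the missing flow. -/

open Classical in
/-- When the source is saturated, every pair of consecutive levels bounds the missing flow. -/
theorem State.Valid.nu_le (h : σ.Valid D s t G) (hst : s ≠ t) (hc : σ.cur = s)
    (hsat : ∀ v, G.Adj s v → σ.flow s v = 1) {i : ℕ} (hi : i < D) :
    (nu s t G : ℤ) ≤ excess σ.flow t +
      2 * ((univ.filter fun x => σ.label x = i + 1).card *
        (univ.filter fun x => σ.label x = i).card) := by
  set S : Finset V := univ.filter fun x => i + 1 ≤ σ.label x with hS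
  have hsS : s ∈ S := by simp [hS, h.label_source]; omega
  have htS : t ∉ S := by simp [hS, h.label_target]
  have h1 : (cutSize G S : ℤ) ≤ ∑ a ∈ S, ∑ b ∈ Sᶜ, (σ.flow a b +
      2 * ((if σ.label a = i + 1 then 1 else 0) * (if σ.label b = i then 1 else 0))) := by
    rw [cutSize_eq_sum]
    push_cast
    refine sum_le_sum fun a ha => sum_le_sum fun b hb => ?_
    have ha' : i + 1 ≤ σ.label a := by simpa [hS] using ha
    have hb' : σ.label b < i + 1 := by simpa [hS] using hb
    have hlow : -1 ≤ σ.flow a b := by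
      have := h.preflow.antisymm a b
      have := h.preflow.le_one b a
      omega
    by_cases hab : G.Adj a b
    · by_cases hf : σ.flow a b = 1
      · rw [hf, if_pos hab]
        split_ifs <;> simp
      -- An unsaturated edge across the cut joins level `i + 1` to level `i`. It misses at most `1 -
      -- (-1) = 2` units.
      · have has : a ≠ s := by
          rintro rfl
          exact hf (hsat b hab)
        have hl := h.label_le_succ a b has hab hf
        rw [if_pos hab, if_pos (by omega), if_pos (by omega)]
        omega
    · have hf : σ.flow a b = 0 := by
        by_contra hne
        exact hab (h.preflow.adj a b hne)
      rw [if_neg hab, hf]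
      split_ifs <;> simp
  -- Stranded excess has label `D + 1`, hence lies in `S`.
  have h2 : ∑ b ∈ Sᶜ, excess σ.flow b = excess σ.flow t := by
    refine sum_eq_single_of_mem t (mem_compl.2 htS) fun b hb hbt => ?_
    have hb' : σ.label b < i + 1 := by simpa [hS] using hb
    have hbs : b ≠ s := by
      rintro rfl
      exact mem_compl.1 hb hsS
    rw [h.excess_eq b hbs hbt (by omega), hc, if_neg hbs]
  have h3 : ∑ a ∈ S, ∑ b ∈ Sᶜ,
      ((if σ.label a = i + 1 then (1 : ℤ) else 0) * (if σ.label b = i then 1 else 0)) ≤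
      (univ.filter fun x => σ.label x = i + 1).card *
        (univ.filter fun x => σ.label x = i).card := by
    rw [← sum_mul_sum]
    have key : ∀ (T : Finset V) (j : ℕ), ∑ a ∈ T, (if σ.label a = j then (1 : ℤ) else 0) ≤
        (univ.filter fun x => σ.label x = j).card := by
      intro T j
      rw [← sum_filter, sum_const, nsmul_one]
      exact_mod_cast card_le_card (filter_subset_filter _ (subset_univ T))
    exact mul_le_mul (key _ _) (key _ _) (sum_nonneg fun _ _ => by split_ifs <;> simp) (by simp)
  have h4 : (nu s t G : ℤ) ≤ cutSize G S := by exact_mod_cast nu_le_cutSize G hsS htS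
  simp only [sum_add_distrib, ← mul_sum, sum_cut_eq_sum_excess h.preflow.antisymm, h2] at h1
  simp only [← mul_sum] at h3
  linarith

open Classical in
theorem sum_card_levels_le (d : V → ℕ) (D : ℕ) :
    ∑ i ∈ range D, (univ.filter fun x => d x = i).card ≤ Fintype.card V := by
  rw [← card_biUnion]
  · exact card_le_univ _
  · intro i _ j _ hij
    rw [Function.onFun, Finset.disjoint_left]
    intro x hx hx'
    simp only [mem_filter] at hx hx'
    omega

/-- Otherwise consecutive level sizes have product above `k/4`, so by AM-GM their sum exceeds `√k`.
Summing over `D` pairs counts each vertex at most twice, giving `D√k < 2n`. -/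
theorem State.Valid.sub_half_le_excess (h : σ.Valid D s t G) (hst : s ≠ t) (hc : σ.cur = s)
    (hsat : ∀ v, G.Adj s v → σ.flow s v = 1) {k : ℝ} (hk : 0 < k)
    (hD : 2 * Fintype.card V / √k ≤ D) :
    (nu s t G : ℝ) - k / 2 ≤ excess σ.flow t := by
  classical
  by_contra! hlt
  set L : ℕ → ℕ := fun i => (univ.filter fun x => σ.label x = i).card with hL
  have hpos : 0 < Fintype.card V := Fintype.card_pos_iff.2 ⟨s⟩
  have hsk : 0 < √k := Real.sqrt_pos.2 hk
  have hDpos : 0 < D := by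
    have : (0 : ℝ) < D := lt_of_lt_of_le (by positivity) hD
    exact_mod_cast this
  have hlev : ∀ i ∈ range D, √k < (L (i + 1) : ℝ) + L i := by
    intro i hi
    have h1 : (nu s t G : ℝ) ≤ excess σ.flow t + 2 * (L (i + 1) * L i) := by
      exact_mod_cast h.nu_le hst hc hsat (mem_range.1 hi)
    have h2 := (L i).cast_nonneg (α := ℝ)
    have h3 := (L (i + 1)).cast_nonneg (α := ℝ)
    rw [Real.sqrt_lt' (by by_contra! h0; nlinarith)]
    nlinarith [sq_nonneg ((L (i + 1) : ℝ) - L i)]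
  have hsum := sum_lt_sum_of_nonempty (nonempty_range_iff.2 hDpos.ne') hlev
  rw [sum_const, card_range, nsmul_eq_mul, sum_add_distrib] at hsum
  have e1 : ∑ i ∈ range D, (L i : ℝ) ≤ Fintype.card V := by
    exact_mod_cast sum_card_levels_le σ.label D
  have e2 : ∑ i ∈ range D, (L (i + 1) : ℝ) ≤ Fintype.card V := by
    have e3 : ∑ i ∈ range (D + 1), (L i : ℝ) ≤ Fintype.card V := by
      exact_mod_cast sum_card_levels_le σ.label (D + 1)
    rw [sum_range_succ'] at e3
    have := (L 0).cast_nonneg (α := ℝ)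
    linarith
  rw [div_le_iff₀ hsk] at hD
  linarith

theorem exists_algorithm (hst : s ≠ t) {k : ℝ} (hk : 0 < k) (D : ℕ)
    (hD : 2 * Fintype.card V / √k ≤ D) :
    ∃ A : Algorithm V (SimpleGraph V), ∀ G : SimpleGraph V,
      A.numQueries G ≤
        3 * (Nat.clog 2 (Fintype.card V) + 1) * (3 * Fintype.card V * (D + 3)) ∧
      A.result G ≤ G ∧ (nu s t G : ℝ) - k / 2 ≤ nu s t (A.result G) := by
  obtain ⟨σ, hσ, hpot⟩ := exists_valid_state hst D
  obtain ⟨A, hA⟩ := exists_loop hst D (3 * Fintype.card V * (D + 3)) σ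
  refine ⟨A.bind fun τ => .output (supportGraph τ.flow), fun G => ?_⟩
  obtain ⟨h1, h2, h3, h4⟩ := hA G (hσ G) hpot
  rw [Algorithm.numQueries_bind, Algorithm.result_bind]
  refine ⟨h1, h2.preflow.supportGraph_le, (h2.sub_half_le_excess hst h3 h4 hk hD).trans ?_⟩
  exact_mod_cast h2.preflow.excess_le_nu_supportGraph hst

end Preflow

/-! ### Numerical bounds and conclusion. -/

theorem clog_two_add_one_le {n : ℕ} (hn : 2 ≤ n) :
    ((Nat.clog 2 n + 1 : ℕ) : ℝ) ≤ 5 * Real.log n := by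
  have hn' : (2 : ℝ) ≤ n := by exact_mod_cast hn
  have hlog : Real.log 2 ≤ Real.log n := Real.log_le_log (by norm_num) hn'
  have h2 := Real.log_two_gt_d9
  have h1 : ((Nat.clog 2 n - 1 : ℕ) : ℝ) * Real.log 2 ≤ Real.log n := by
    rw [← Real.log_pow]
    refine Real.log_le_log (by positivity) ?_
    exact_mod_cast (Nat.pow_pred_clog_lt_self one_lt_two (by omega)).le
  have h3 : (Nat.clog 2 n : ℝ) ≤ ((Nat.clog 2 n - 1 : ℕ) : ℝ) + 1 := by
    exact_mod_cast (by omega : Nat.clog 2 n ≤ Nat.clog 2 n - 1 + 1)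
  have h0 : (0 : ℝ) ≤ ((Nat.clog 2 n - 1 : ℕ) : ℝ) := Nat.cast_nonneg _
  push_cast
  nlinarith

end CutQuery

theorem mainTheorem5 :
    ∃ (C : ℝ) (c : ℕ),
      ∀ (V : Type*) [Fintype V] (s t : V), s ≠ t →
      ∀ (f k : ℝ), 0 < k →
      ∀ (H : SimpleGraph V), f - k ≤ (CutQuery.nu s t H : ℝ) →
      ∃ A : CutQuery.Algorithm V (SimpleGraph V),
        ∀ (G : SimpleGraph V), H ≤ G → f ≤ (CutQuery.nu s t G : ℝ) →
          (A.numQueries G : ℝ) ≤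
              C * ((Fintype.card V : ℝ) ^ 2 / Real.sqrt k) *
                Real.log (Fintype.card V : ℝ) ^ c ∧
            A.result G ≤ G ∧
            f - k / 2 ≤ (CutQuery.nu s t (A.result G) : ℝ) := by
  refine ⟨450, 1, fun V _ s t hst f k hk H _ => ?_⟩
  have hn : 2 ≤ Fintype.card V := Fintype.one_lt_card_iff.2 ⟨s, t, hst⟩
  have hlog : 0 ≤ Real.log (Fintype.card V) := Real.log_natCast_nonneg _
  -- For such `k` the target `f - k/2` is negative, since `f ≤ ν(G) ≤ n`, and the edgeless graph
  -- suffices.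
  by_cases hbig : 4 * (Fintype.card V : ℝ) < k
  · refine ⟨.output ⊥, fun G _ hf => ⟨?_, bot_le, ?_⟩⟩
    · simp only [CutQuery.Algorithm.numQueries, Nat.cast_zero]
      positivity
    · have h1 : (CutQuery.nu s t G : ℝ) ≤ Fintype.card V := by
        exact_mod_cast CutQuery.nu_le_card hst G
      have h2 : (0 : ℝ) ≤ CutQuery.nu s t (⊥ : SimpleGraph V) := Nat.cast_nonneg _
      have h3 : (0 : ℝ) ≤ Fintype.card V := Nat.cast_nonneg _
      simp only [CutQuery.Algorithm.result]
      linarith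
  · push Not at hbig
    obtain ⟨D, hD₁, hD₂⟩ : ∃ D : ℕ, 2 * Fintype.card V / √k ≤ D ∧
        (D : ℝ) ≤ 2 * Fintype.card V / √k + 1 :=
      ⟨_, Nat.le_ceil _, (Nat.ceil_lt_add_one (by positivity)).le⟩
    obtain ⟨A, hA⟩ := CutQuery.exists_algorithm hst hk D hD₁
    refine ⟨A, fun G _ hf => ?_⟩
    obtain ⟨h1, h2, h3⟩ := hA G
    refine ⟨?_, h2, by linarith⟩
    have hq := CutQuery.clog_two_add_one_le hn
    set n : ℝ := (Fintype.card V : ℝ) with hn_def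
    have hn2 : (2 : ℝ) ≤ n := by rw [hn_def]; exact_mod_cast hn
    have hsk : 0 < √k := Real.sqrt_pos.2 hk
    -- Since `k ≤ 4n`, the ratio `x = n/√k` is at least `1/2`, so `D + 3 ≤ 2x + 4 ≤ 10x`.
    have hD : (D : ℝ) + 3 ≤ 10 * (n / √k) := by
      have h5 : √k ≤ 2 * n := by
        rw [Real.sqrt_le_left (by positivity)]
        nlinarith
      have h6 : 1 / 2 ≤ n / √k := by
        rw [le_div_iff₀ hsk]
        linarith
      have h7 : 2 * n / √k = 2 * (n / √k) := by ring
      linarith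
    calc (A.numQueries G : ℝ)
        ≤ 3 * ((Nat.clog 2 (Fintype.card V) + 1 : ℕ) : ℝ) *
            (3 * n * ((D : ℝ) + 3)) := by rw [hn_def]; exact_mod_cast h1
      _ ≤ 3 * (5 * Real.log n) * (3 * n * (10 * (n / √k))) := by gcongr
      _ = 450 * (n ^ 2 / √k) * Real.log n ^ 1 := by ring
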